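/- Let $n,m\ge 1$ be integers, let $H$ be a complex Hilbert space and let $T=(T_1,\dots,T_n)\in L(H)^n$ be a commuting tuple of bounded operators. Put $\sigma_T(X)=\sum_{i=1}^n T_iXT_i^*$ for $X\in L(H)$ and $\Delta_T^{(k)}=(1-\sigma_T)^k(1_H)$. Suppose that $T$ is a pure $m$-hypercontraction, that is, $\Delta_T^{(1)}\ge 0$, $\Delta_T^{(m)}\ge 0$, and $\sigma_T^k(1_H)\to 0$ strongly as $k\to\infty$. Regard $T$ as a row operator $H^n\to H$, $(h_i)\mapsto\sum_i T_ih_i$, and let $D_T=(1-T^*T)^{1/2}\in L(H^n)$, $D_{T^*}=(1-TT^*)^{1/2}\in L(H)$, $\mathcal D_T=\overline{D_TH^n}$, $\mathcal D_{T^*}=\overline{D_{T^*}H}$, $C=(\Delta_T^{(m)})^{1/2}$, $\mathcal D=\overline{CH}$. Let $\mathbb B\subset\mathbb C^n$ be the open Euclidean unit ball and, for an integer $\ell\ge 0$, let $H_\ell(\mathbb B,\mathcal D)$ be the Hilbert space of $\mathcal D$-valued functions on $\mathbb B$ with reproducing kernel $(1-\langle z,w\rangle)^{-\ell}1_{\mathcal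 D}$; explicitly, it consists of the functions $f=\sum_\alpha f_\alpha z^\alpha$ with $\|f\|^2=\sum_\alpha\|f_\alpha\|^2/\rho_\ell(\alpha)<\infty$, where $\rho_\ell(\alpha)=\frac{(\ell+|\alpha|-1)!}{\alpha!(\ell-1)!}$ for $\ell\ge1$, and $H_0(\mathbb B,\mathcal D)=\mathcal D$ consists of the constant functions (so $\rho_0(0)=1$ and $\rho_0(\alpha)=0$ for $\alpha\neq0$). Let $\pi:H\to H_{m-1}(\mathbb B,\mathcal D)$, $\pi(x)=\sum_\alpha\rho_{m-1}(\alpha)(CT^{*\alpha}x)z^\alpha$, and $M=H_{m-1}(\mathbb B,\mathcal D)\ominus\operatorname{Im}\pi$. Then $\|\pi x\|=\|D_{T^*}x\|$ for all $x\in H$; let $U:\mathcal D_{T^*}\to\overline{\operatorname{Im}\pi}$ be the unitary operator with $UD_{T^*}x=\pi x$ and put $V=(U,i_M):\mathcal D_{T^*}\oplus M\to H_{m-1}(\mathbb B,\mathcal D)$, where $i_M$ is the inclusion. With the point evaluations $\epsilon_z(f)=f(z)$, let $\Delta_1(z)=\epsilon_zV$ and $\Delta_0=\epsilon_0U$. The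 characteristic function of $T$ is $\theta_T:\mathbb B\to L(\mathcal D_T\oplus M,\mathcal D)$, $$\theta_T(z)=-\Delta_1(z)(T\oplus 1_M)+\Delta_0D_{T^*}(1_H-ZT^*)^{-m}Z(D_T,0),$$ where $Z:H^n\to H$, $(h_i)\mapsto\sum_iz_ih_i$. Then $\|\theta_T(0)x\|<\|x\|$ for every non-zero $x\in\mathcal D_T\oplus M$. -/

import Mathlib

noncomputable section

open Filter Topology

namespace Hypercontraction

/-- The coefficient `ρ_ℓ(α) = (ℓ + |α| - 1)! / (α! (ℓ - 1)!)` of `(1 - ⟨z, w⟩)^(-ℓ)` at the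
multiindex `α`, written as `C(ℓ + |α| - 1, |α|) · |α|! / α!`. For `ℓ = 0` it is `1` at `α = 0`
and `0` elsewhere. -/
def rho {n : ℕ} (l : ℕ) (α : Fin n → ℕ) : ℕ :=
  Nat.multichoose l (∑ i, α i) * Nat.multinomial Finset.univ α

theorem rho_succ_mul {n : ℕ} (l : ℕ) (α : Fin n → ℕ) :
    rho (l + 1) α * ((∏ i, (α i).factorial) * l.factorial) = (l + ∑ i, α i).factorial := by
  have h1 := Nat.multinomial_spec Finset.univ α
  have h2 := Nat.add_choose_mul_factorial_mul_factorial l (∑ i, α i)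
  rw [rho, Nat.multichoose_eq, show l + 1 + ∑ i, α i - 1 = l + ∑ i, α i by omega, ← h2,
    ← h1]
  ring

theorem sum_multichoose (k l : ℕ) :
    ∑ j ∈ Finset.range (l + 1), Nat.multichoose k j = Nat.multichoose (k + 1) l := by
  induction l with
  | zero => simp
  | succ l ih => rw [Finset.sum_range_succ, ih, Nat.multichoose_succ_succ, add_comm]

/-- Nonnegative families over multiindices may be summed degree by degree. -/
theorem hasSum_of_degree {n : ℕ} {F : (Fin n → ℕ) → ℝ} (hF : ∀ α, 0 ≤ F α) {s : ℝ}
    (h : HasSum (fun j => ∑ α ∈ Finset.piAntidiag Finset.univ j, F α) s) : HasSum F s := by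
  classical
  have key : ∀ j, (∑' x : {α : Fin n → ℕ // ∑ i, α i = j}, F x)
      = ∑ α ∈ Finset.piAntidiag Finset.univ j, F α := by
    intro j
    have : ({α : Fin n → ℕ | ∑ i, α i = j}) = ↑(Finset.piAntidiag (Finset.univ : Finset (Fin n)) j) := by
      ext α; simp
    rw [← Finset.tsum_subtype]
    exact tsum_congr_set_coe F this
  have fin : ∀ j, Finite {α : Fin n → ℕ // ∑ i, α i = j} := by
    intro j
    refine Set.Finite.subset (Finset.piAntidiag (Finset.univ : Finset (Fin n)) j).finite_toSet ?_
    intro α hα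
    have h : ∑ i, α i = j := hα
    simpa using h
  let e := Equiv.sigmaFiberEquiv (fun α : Fin n → ℕ => ∑ i, α i)
  have hs : Summable (fun x => F (e x)) := by
    rw [summable_sigma_of_nonneg (fun x => hF _)]
    refine ⟨fun j => ?_, ?_⟩
    · have := fin j
      exact Summable.of_finite
    · refine h.summable.congr fun j => ?_
      exact (key j).symm
  have hs' : Summable F := (e.summable_iff).1 hs
  have : ∑' α, F α = s := by
    rw [← e.tsum_eq, hs.tsum_sigma' (fun j => by
      have := fin j
      exact Summable.of_finite), ← h.tsum_eq]
    exact tsum_congr fun j => key j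
  exact this ▸ hs'.hasSum

theorem hasSum_degree {n : ℕ} {E : Type*} [NormedAddCommGroup E] [CompleteSpace E]
    {F : (Fin n → ℕ) → E} {s : E} (h : HasSum F s) :
    HasSum (fun j => ∑ α ∈ Finset.piAntidiag Finset.univ j, F α) s := by
  classical
  have h1 := (Equiv.sigmaFiberEquiv (fun α : Fin n → ℕ => ∑ i, α i)).hasSum_iff.2 h
  refine h1.sigma fun j => ?_
  have : ({α : Fin n → ℕ | ∑ i, α i = j}) = ↑(Finset.piAntidiag (Finset.univ : Finset (Fin n)) j) := by
    ext α; simp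
  have h2 := Finset.hasSum (Finset.piAntidiag (Finset.univ : Finset (Fin n)) j) F
  have h3 : HasSum (fun x : ({α : Fin n → ℕ | ∑ i, α i = j}) => F x)
      (∑ α ∈ Finset.piAntidiag (Finset.univ : Finset (Fin n)) j, F α) := by
    rw [this]; exact h2
  exact h3

theorem hasSum_multichoose {𝕜 : Type*} [NormedField 𝕜] [CompleteSpace 𝕜] (l : ℕ) {r : 𝕜} (hr : ‖r‖ < 1) :
    HasSum (fun j => (Nat.multichoose l j : 𝕜) * r ^ j) (((1 - r) ^ l)⁻¹) := by
  cases l with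
  | zero =>
    simpa using hasSum_single (f := fun j => (Nat.multichoose 0 j : 𝕜) * r ^ j) 0
      (fun j hj => by obtain ⟨j, rfl⟩ := Nat.exists_eq_succ_of_ne_zero hj; simp)
  | succ l =>
    have h := hasSum_choose_mul_geometric_of_norm_lt_one l hr
    rw [one_div] at h
    refine h.congr_fun fun j => ?_
    rw [Nat.multichoose_eq, show l + 1 + j - 1 = j + l by omega, Nat.choose_symm_add]

theorem sum_rho_degree {n : ℕ} {R : Type*} [CommSemiring R] (l j : ℕ) (u : Fin n → R) :
    ∑ α ∈ Finset.piAntidiag Finset.univ j, (rho l α : R) * ∏ i, u i ^ α i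
      = (Nat.multichoose l j : R) * (∑ i, u i) ^ j := by
  rw [Finset.sum_pow_eq_sum_piAntidiag, Finset.mul_sum]
  refine Finset.sum_congr rfl fun α hα => ?_
  rw [Finset.mem_piAntidiag] at hα
  rw [rho, hα.1]; push_cast; ring


/-! ### The spaces `H_ℓ(𝔹, E)` -/

/-- The open Euclidean unit ball of `ℂⁿ`. -/
abbrev Ball (n : ℕ) : Set (EuclideanSpace ℂ (Fin n)) := Metric.ball 0 1

/-- The origin as a point of the ball. -/
def Ball.origin (n : ℕ) : Ball n := ⟨0, Metric.mem_ball_self one_pos⟩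

/-- The monomial `z ^ α`. -/
def monomial {n : ℕ} (z : EuclideanSpace ℂ (Fin n)) (α : Fin n → ℕ) : ℂ := ∏ i, z i ^ α i

/-- The multiindices which occur in `H_ℓ(𝔹, E)`: all of them for `ℓ ≥ 1`, only `0` for `ℓ = 0`. -/
abbrev Idx (n l : ℕ) : Type := {α : Fin n → ℕ // rho l α ≠ 0}

/-- The functional Hilbert space `H_ℓ(𝔹, E)` of all functions `f = ∑ f_α z ^ α` on the unit ball
with `‖f‖² = ∑ ‖f_α‖² / ρ_ℓ(α) < ∞`. The function `f` is stored through the square summable family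
of its normalized coefficients `x_α = f_α / ρ_ℓ(α) ^ (1/2)`; its values are given by the
`RKHS` instance below. -/
def HSpace (n l : ℕ) (E : Type*) [NormedAddCommGroup E] : Type _ :=
  lp (fun _ : Idx n l => E) 2

section HSpace

variable {n l : ℕ} {E : Type*} [NormedAddCommGroup E]

instance : NormedAddCommGroup (HSpace n l E) :=
  inferInstanceAs (NormedAddCommGroup (lp (fun _ : Idx n l => E) 2))

instance [InnerProductSpace ℂ E] : InnerProductSpace ℂ (HSpace n l E) :=
  inferInstanceAs (InnerProductSpace ℂ (lp (fun _ : Idx n l => E) 2))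

instance [CompleteSpace E] : CompleteSpace (HSpace n l E) :=
  inferInstanceAs (CompleteSpace (lp (fun _ : Idx n l => E) 2))

/-- The normalized coefficient `x_α = f_α / ρ_ℓ(α) ^ (1/2)` of `f`. -/
def HSpace.ncoeff (f : HSpace n l E) (α : Idx n l) : E :=
  (show lp (fun _ : Idx n l => E) 2 from f) α

/-- The element of `H_ℓ(𝔹, E)` with given square summable normalized coefficients. -/
def HSpace.mk (x : Idx n l → E) (hx : Summable fun α => ‖x α‖ ^ 2) : HSpace n l E :=
  (⟨x, memℓp_gen (by simpa using hx)⟩ : lp (fun _ : Idx n l => E) 2)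

@[simp] theorem HSpace.ncoeff_mk (x : Idx n l → E) (hx : Summable fun α => ‖x α‖ ^ 2) :
    (HSpace.mk x hx).ncoeff = x := rfl

@[ext] theorem HSpace.ext_ncoeff {f g : HSpace n l E} (h : ∀ α, f.ncoeff α = g.ncoeff α) :
    f = g := lp.ext (funext h)

@[simp] theorem HSpace.ncoeff_add (f g : HSpace n l E) (α : Idx n l) :
    (f + g).ncoeff α = f.ncoeff α + g.ncoeff α := rfl

@[simp] theorem HSpace.ncoeff_smul [InnerProductSpace ℂ E] (c : ℂ) (f : HSpace n l E)
    (α : Idx n l) : (c • f).ncoeff α = c • f.ncoeff α := rfl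

theorem HSpace.hasSum_norm_sq (f : HSpace n l E) :
    HasSum (fun α => ‖f.ncoeff α‖ ^ 2) (‖f‖ ^ 2) := by
  have := lp.hasSum_norm (p := 2) (by norm_num) (show lp (fun _ : Idx n l => E) 2 from f)
  simpa using! this

theorem HSpace.inner_eq_tsum [InnerProductSpace ℂ E] (f g : HSpace n l E) :
    inner ℂ f g = ∑' α, inner ℂ (f.ncoeff α) (g.ncoeff α) := rfl

theorem hasSum_idx_iff {G : Type*} [AddCommMonoid G] [TopologicalSpace G] (F : (Fin n → ℕ) → G)
    (hF : ∀ α, rho l α = 0 → F α = 0) {s : G} :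
    HasSum (fun α : Idx n l => F α.1) s ↔ HasSum F s :=
  hasSum_subtype_iff_of_support_subset (s := {α : Fin n → ℕ | rho l α ≠ 0})
    fun α hα h => hα (hF α h)

theorem hasSum_rho_norm (l : ℕ) {z : EuclideanSpace ℂ (Fin n)} (hz : z ∈ Ball n) :
    HasSum (fun α : Fin n → ℕ => (rho l α : ℝ) * ‖monomial z α‖ ^ 2) (((1 - ‖z‖ ^ 2) ^ l)⁻¹) := by
  have h0 : ‖z‖ < 1 := by simpa using hz
  refine hasSum_of_degree (fun α => by positivity) ?_
  have h1 : ‖(‖z‖ ^ 2 : ℝ)‖ < 1 := by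
    rw [norm_pow, norm_norm]; exact pow_lt_one₀ (norm_nonneg _) h0 (by norm_num)
  have h2 : HasSum (fun j => (Nat.multichoose l j : ℝ) * (‖z‖ ^ 2) ^ j)
      (((1 - ‖z‖ ^ 2) ^ l)⁻¹) := hasSum_multichoose l h1
  refine h2.congr_fun fun j => ?_
  rw [EuclideanSpace.norm_sq_eq, ← sum_rho_degree]
  refine Finset.sum_congr rfl fun α _ => ?_
  simp_rw [monomial, norm_prod, norm_pow, ← Finset.prod_pow, ← pow_mul, mul_comm 2]

theorem hasSum_rho_monomial (l : ℕ) {z w : EuclideanSpace ℂ (Fin n)} (hz : z ∈ Ball n)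
    (hw : w ∈ Ball n) : HasSum (fun α : Idx n l => (rho l α.1 : ℂ) *
      (monomial z α.1 * starRingEnd ℂ (monomial w α.1))) (((1 - inner ℂ w z) ^ l)⁻¹) := by
  have hs : Summable (fun α : Fin n → ℕ => (rho l α : ℂ) *
      (monomial z α * starRingEnd ℂ (monomial w α))) := by
    refine Summable.of_norm_bounded
      ((hasSum_rho_norm l hz).summable.add (hasSum_rho_norm l hw).summable) fun α => ?_
    rw [norm_mul, norm_mul, RCLike.norm_conj, Complex.norm_natCast, ← mul_add]
    gcongr
    nlinarith [sq_nonneg (‖monomial z α‖ - ‖monomial w α‖), sq_nonneg ‖monomial z α‖,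
      sq_nonneg ‖monomial w α‖]
  have h1 : ‖inner ℂ w z‖ < 1 := by
    have hz' : ‖z‖ < 1 := by simpa using hz
    have hw' : ‖w‖ < 1 := by simpa using hw
    refine (norm_inner_le_norm w z).trans_lt ?_
    nlinarith [norm_nonneg z, norm_nonneg w]
  have h2 : HasSum (fun α : Fin n → ℕ => (rho l α : ℂ) *
      (monomial z α * starRingEnd ℂ (monomial w α))) (((1 - inner ℂ w z) ^ l)⁻¹) := by
    have h3 := (hasSum_degree hs.hasSum).unique
      ((hasSum_multichoose l h1).congr_fun fun j => by
        rw [PiLp.inner_apply, ← sum_rho_degree]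
        refine Finset.sum_congr rfl fun α _ => ?_
        simp [monomial, mul_pow, Finset.prod_mul_distrib])
    exact h3 ▸ hs.hasSum
  exact (hasSum_idx_iff _ fun α h => by rw [h, Nat.cast_zero, zero_mul]).2 h2

variable [InnerProductSpace ℂ E]

/-- The value `f(z) = ∑ f_α z ^ α = ∑ ρ_ℓ(α) ^ (1/2) z ^ α x_α`. -/
def HSpace.eval (f : HSpace n l E) (z : Ball n) : E :=
  ∑' α : Idx n l, ((√(rho l α.1 : ℝ) : ℂ) * monomial z.1 α.1) • f.ncoeff α

theorem HSpace.norm_eval_le (f : HSpace n l E) (z : Ball n) :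
    ‖f.eval z‖ ≤ √(((1 - ‖z.1‖ ^ 2) ^ l)⁻¹) * ‖f‖ := by
  have h : ∀ α : Idx n l, ‖((√(rho l α.1 : ℝ) : ℂ) * monomial z.1 α.1)‖ ^ 2
      = (rho l α.1 : ℝ) * ‖monomial z.1 α.1‖ ^ 2 := fun α => by
    rw [norm_mul, mul_pow, Complex.norm_real, Real.norm_eq_abs, sq_abs, Real.sq_sqrt (by positivity)]
  have hA : HasSum (fun α : Idx n l => ‖((√(rho l α.1 : ℝ) : ℂ) * monomial z.1 α.1)‖ ^ 2)
      (((1 - ‖z.1‖ ^ 2) ^ l)⁻¹) := by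
    simp_rw [h]
    exact (hasSum_idx_iff (fun α => (rho l α : ℝ) * ‖monomial z.1 α‖ ^ 2) fun α h => by
      rw [h, Nat.cast_zero, zero_mul]).2 (hasSum_rho_norm l z.2)
  have hB := f.hasSum_norm_sq
  have hnn : 0 ≤ ((1 - ‖z.1‖ ^ 2) ^ l)⁻¹ := hA.nonneg fun _ => by positivity
  have h1 := Real.summable_mul_of_Lp_Lq_of_nonneg (p := 2) (q := 2)
    (f := fun α : Idx n l => ‖((√(rho l α.1 : ℝ) : ℂ) * monomial z.1 α.1)‖)
    (g := fun α => ‖f.ncoeff α‖) Real.HolderConjugate.two_two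
    (fun _ => norm_nonneg _) (fun _ => norm_nonneg _)
    (by simpa using hA.summable) (by simpa using hB.summable)
  have h2 := Real.inner_le_Lp_mul_Lq_tsum_of_nonneg (p := 2) (q := 2)
    (f := fun α : Idx n l => ‖((√(rho l α.1 : ℝ) : ℂ) * monomial z.1 α.1)‖)
    (g := fun α => ‖f.ncoeff α‖) Real.HolderConjugate.two_two
    (fun _ => norm_nonneg _) (fun _ => norm_nonneg _)
    (by simpa using hA.summable) (by simpa using hB.summable)
  simp only [Real.rpow_two, hA.tsum_eq, hB.tsum_eq] at h2
  rw [← Real.sqrt_eq_rpow, ← Real.sqrt_eq_rpow, Real.sqrt_sq (norm_nonneg _)] at h2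
  refine le_trans ?_ h2
  simp_rw [← norm_smul] at h1 ⊢
  exact norm_tsum_le_tsum_norm h1

variable [CompleteSpace E]

theorem HSpace.summable_eval (f : HSpace n l E) (z : Ball n) :
    Summable fun α : Idx n l => ((√(rho l α.1 : ℝ) : ℂ) * monomial z.1 α.1) • f.ncoeff α := by
  refine Summable.of_norm_bounded
    (((hasSum_rho_norm l z.2).summable.subtype {α | rho l α ≠ 0}).add f.hasSum_norm_sq.summable)
    fun α => ?_
  have h : ‖((√(rho l α.1 : ℝ) : ℂ) * monomial z.1 α.1)‖ ^ 2
      = (rho l α.1 : ℝ) * ‖monomial z.1 α.1‖ ^ 2 := by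
    rw [norm_mul, mul_pow, Complex.norm_real, Real.norm_eq_abs, sq_abs, Real.sq_sqrt (by positivity)]
  rw [norm_smul, Function.comp_apply, ← h]
  generalize ‖((√(rho l α.1 : ℝ) : ℂ) * monomial z.1 α.1)‖ = a
  nlinarith [sq_nonneg (a - ‖f.ncoeff α‖), sq_nonneg a, sq_nonneg ‖f.ncoeff α‖]

theorem eq_zero_of_powerSeries {a : (Fin n → ℕ) → ℂ}
    (h : ∀ z ∈ Ball n, HasSum (fun α => a α * monomial z α) 0) : a = 0 := by
  have hom : ∀ (t : ℂ) (z : EuclideanSpace ℂ (Fin n)) (j : ℕ),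
      ∑ α ∈ Finset.piAntidiag Finset.univ j, a α * monomial (t • z) α
        = t ^ j * ∑ α ∈ Finset.piAntidiag Finset.univ j, a α * monomial z α := by
    intro t z j
    rw [Finset.mul_sum]
    refine Finset.sum_congr rfl fun α hα => ?_
    rw [Finset.mem_piAntidiag] at hα
    simp only [monomial, PiLp.smul_apply, smul_eq_mul, mul_pow, Finset.prod_mul_distrib,
      Finset.prod_pow_eq_pow_sum, hα.1]
    ring
  have key : ∀ z ∈ Ball n, ∀ j,
      ∑ α ∈ Finset.piAntidiag Finset.univ j, a α * monomial z α = 0 := by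
    intro z hz
    set c : ℕ → ℂ := fun j => ∑ α ∈ Finset.piAntidiag Finset.univ j, a α * monomial z α with hc
    have hp : HasFPowerSeriesAt (fun _ : ℂ => (0 : ℂ)) (FormalMultilinearSeries.ofScalars ℂ c) 0 := by
      rw [hasFPowerSeriesAt_iff]
      filter_upwards [Metric.ball_mem_nhds (0 : ℂ) one_pos] with t ht
      have ht' : ‖t‖ < 1 := by simpa using ht
      have hz' : ‖z‖ < 1 := by simpa using hz
      have htz : t • z ∈ Ball n := by
        simp only [mem_ball_zero_iff, norm_smul]
        nlinarith [norm_nonneg t, norm_nonneg z]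
      refine (hasSum_degree (h _ htz)).congr_fun fun j => ?_
      rw [hom, FormalMultilinearSeries.coeff_ofScalars, smul_eq_mul]
    intro j
    have := hp.eq_zero
    have h2 : (FormalMultilinearSeries.ofScalars ℂ c).coeff j = 0 := by rw [this]; rfl
    rwa [FormalMultilinearSeries.coeff_ofScalars] at h2
  have key2 : ∀ (z : EuclideanSpace ℂ (Fin n)) (j : ℕ),
      ∑ α ∈ Finset.piAntidiag Finset.univ j, a α * monomial z α = 0 := by
    intro z j
    have hpos : (0 : ℝ) < ‖z‖ + 1 := by positivity
    have hb : ((‖z‖ + 1 : ℝ) : ℂ)⁻¹ • z ∈ Ball n := by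
      rw [mem_ball_zero_iff, norm_smul, norm_inv, Complex.norm_real, Real.norm_of_nonneg hpos.le,
        inv_mul_lt_iff₀ hpos]
      linarith
    have := key _ hb j
    rw [hom] at this
    exact (mul_eq_zero.1 this).resolve_left
      (pow_ne_zero _ (inv_ne_zero (by exact_mod_cast hpos.ne')))
  funext β
  set P : MvPolynomial (Fin n) ℂ := ∑ α ∈ Finset.piAntidiag Finset.univ (∑ i, β i),
    MvPolynomial.monomial (Finsupp.equivFunOnFinite.symm α) (a α) with hP
  have hP0 : P = 0 := by
    refine MvPolynomial.funext fun x => ?_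
    have := key2 (WithLp.toLp 2 x) (∑ i, β i)
    simp only [hP, map_sum, MvPolynomial.eval_monomial, map_zero]
    rw [← this]
    refine Finset.sum_congr rfl fun α _ => ?_
    rw [Finsupp.prod_fintype _ _ (by simp)]
    simp [monomial]
  have hco : MvPolynomial.coeff (Finsupp.equivFunOnFinite.symm β) P = a β := by
    rw [hP, MvPolynomial.coeff_sum, Finset.sum_eq_single β]
    · simp
    · intro α _ hne
      rw [MvPolynomial.coeff_monomial, if_neg]
      simpa using hne
    · intro hβ
      exact absurd (by simp) hβ
  rw [← hco, hP0]; simp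

/-- `H_ℓ(𝔹, E)` is a Hilbert space of `E`-valued functions on the ball with continuous point
evaluations. -/
instance : RKHS ℂ (HSpace n l E) (Ball n) E where
  coeCLM := ContinuousLinearMap.pi fun z => LinearMap.mkContinuous
    { toFun := fun f => f.eval z
      map_add' := fun f g => by
        simp only [HSpace.eval, HSpace.ncoeff_add, smul_add]
        exact (f.summable_eval z).tsum_add (g.summable_eval z)
      map_smul' := fun c f => by
        simp only [HSpace.eval, HSpace.ncoeff_smul, RingHom.id_apply]
        rw [← tsum_const_smul'' c]
        simp_rw [smul_comm c] }
    (√(((1 - ‖z.1‖ ^ 2) ^ l)⁻¹)) fun f => f.norm_eval_le z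
  coeCLM_injective := by
    rw [injective_iff_map_eq_zero]
    intro f hf
    have hf' : ∀ z, f.eval z = 0 := fun z => congrFun hf z
    ext β
    refine ext_inner_left ℂ fun e => ?_
    classical
    set a : (Fin n → ℕ) → ℂ := fun α => if hα : rho l α ≠ 0 then
      (√(rho l α : ℝ) : ℂ) * inner ℂ e (f.ncoeff ⟨α, hα⟩) else 0 with ha
    have h0 : a = 0 := by
      refine eq_zero_of_powerSeries fun z hz => ?_
      refine (hasSum_idx_iff (l := l) _ fun α h => ?_).1 ?_
      · simp [ha, h]
      · have h1 := (f.summable_eval ⟨z, hz⟩).hasSum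
        have h2 := (innerSL ℂ e).hasSum h1
        have h3 : (∑' α : Idx n l, ((√(rho l α.1 : ℝ) : ℂ) * monomial z α.1) • f.ncoeff α) = 0 :=
          hf' ⟨z, hz⟩
        rw [h3, map_zero] at h2
        refine h2.congr_fun fun α => ?_
        have := α.2
        simp only [ha, dif_pos this, innerSL_apply_apply, inner_smul_right]
        ring
    have h1 : a β.1 = 0 := by rw [h0]; rfl
    simp only [ha, dif_pos β.2] at h1
    have h2 : (√(rho l β.1 : ℝ) : ℂ) ≠ 0 := by
      have : 0 < (rho l β.1 : ℝ) := by exact_mod_cast Nat.pos_of_ne_zero β.2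
      exact_mod_cast (Real.sqrt_pos.2 this).ne'
    rw [(mul_eq_zero.1 h1).resolve_left h2]
    exact (inner_zero_right e).symm

theorem HSpace.coe_apply (f : HSpace n l E) (z : Ball n) : f z = f.eval z := rfl

/-- The reproducing kernel of `H_ℓ(𝔹, E)` is `K_ℓ(z, w) = (1 - ⟨z, w⟩)^(-ℓ) 1_E`; here
`⟨z, w⟩ = ∑ z_i conj(w_i)` is Mathlib's `inner ℂ w z`. -/
theorem HSpace.kernel_eq (z w : Ball n) :
    RKHS.kernel (HSpace n l E) z w
      = (((1 - inner ℂ w.1 z.1) ^ l)⁻¹ : ℂ) • ContinuousLinearMap.id ℂ E := by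
  ext e
  have hk : ∀ α : Idx n l, (RKHS.kerFun (HSpace n l E) w e).ncoeff α
      = ((√(rho l α.1 : ℝ) : ℂ) * starRingEnd ℂ (monomial w.1 α.1)) • e := by
    have hs : Summable fun α : Idx n l =>
        ‖((√(rho l α.1 : ℝ) : ℂ) * starRingEnd ℂ (monomial w.1 α.1)) • e‖ ^ 2 := by
      refine (((hasSum_rho_norm l w.2).summable.subtype {α | rho l α ≠ 0}).mul_right
        (‖e‖ ^ 2)).congr fun α => ?_
      rw [norm_smul, mul_pow, norm_mul, mul_pow, Complex.norm_real, Real.norm_eq_abs, sq_abs,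
        Real.sq_sqrt (by positivity), RCLike.norm_conj]
      rfl
    have : RKHS.kerFun (HSpace n l E) w e = HSpace.mk _ hs := by
      refine ext_inner_right ℂ fun f => ?_
      rw [RKHS.kerFun_inner, HSpace.inner_eq_tsum, HSpace.coe_apply, HSpace.eval]
      have := (innerSL ℂ e).hasSum (f.summable_eval w).hasSum
      rw [innerSL_apply_apply] at this
      rw [← this.tsum_eq]
      refine tsum_congr fun α => ?_
      simp [mul_comm]
    rw [this]; intro α; rfl
  rw [← RKHS.kerFun_apply, HSpace.coe_apply, HSpace.eval]
  simp_rw [hk, smul_smul]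
  have h1 := (hasSum_rho_monomial l z.2 w.2).smul_const e
  change _ = ((1 - inner ℂ w.1 z.1) ^ l)⁻¹ • e
  rw [← h1.tsum_eq]
  refine tsum_congr fun α => ?_
  congr 1
  have : (√(rho l α.1 : ℝ) : ℂ) * √(rho l α.1 : ℝ) = (rho l α.1 : ℂ) := by
    rw [← Complex.ofReal_mul, Real.mul_self_sqrt (by positivity)]; simp
  rw [← this]; ring

end HSpace

/-! ### Iterated differences of real sequences -/

theorem sum_diff {d : ℕ → ℕ → ℝ} (hd : ∀ i j, d (i + 1) j = d i j - d i (j + 1)) (i j N : ℕ) :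
    ∑ l ∈ Finset.range N, d (i + 1) (j + l) = d i j - d i (j + N) := by
  induction N with
  | zero => simp
  | succ N ih => rw [Finset.sum_range_succ, ih, hd]; ring_nf

theorem diff_nonneg {d : ℕ → ℕ → ℝ} (hd : ∀ i j, d (i + 1) j = d i j - d i (j + 1))
    {B : ℝ} (hB : ∀ j, |d 0 j| ≤ B) (h0 : ∀ j, 0 ≤ d 0 j) {m : ℕ} (hm : ∀ j, 0 ≤ d m j) :
    ∀ i ≤ m, ∀ j, 0 ≤ d i j := by
  have hbd : ∀ i j, |d i j| ≤ 2 ^ i * B := by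
    intro i
    induction i with
    | zero => simpa using hB
    | succ i ih =>
      intro j
      rw [hd, pow_succ]
      have := abs_sub (d i j) (d i (j + 1))
      linarith [ih j, ih (j + 1)]
  have step : ∀ i, (∀ j, 0 ≤ d (i + 2) j) → ∀ j, 0 ≤ d (i + 1) j := by
    intro i h j
    by_contra! hneg
    have hanti : ∀ l, d (i + 1) (j + l) ≤ d (i + 1) j := by
      intro l
      induction l with
      | zero => simp
      | succ l ih =>
        have := h (j + l)
        rw [hd] at this
        rw [← add_assoc]
        linarith
    obtain ⟨N, hN⟩ := exists_nat_gt (2 * (2 ^ i * B) / -d (i + 1) j)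
    rw [div_lt_iff₀ (by linarith)] at hN
    have h1 := sum_diff hd i j N
    have h2 := Finset.sum_le_card_nsmul (Finset.range N) (fun l => d (i + 1) (j + l)) _
      fun l _ => hanti l
    simp only [Finset.card_range, nsmul_eq_mul] at h2
    have h3 := abs_le.1 (hbd i j)
    have h4 := abs_le.1 (hbd i (j + N))
    linarith
  intro i hi
  induction hi using Nat.decreasingInduction with
  | self => exact hm
  | of_succ k hk ih =>
    cases k with
    | zero => exact h0
    | succ k => exact step k ih

theorem hasSum_diff {d : ℕ → ℕ → ℝ} (hd : ∀ i j, d (i + 1) j = d i j - d i (j + 1))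
    {m : ℕ} (hnn : ∀ i ≤ m, ∀ j, 0 ≤ d i j) (hlim : Tendsto (d 0) atTop (𝓝 0)) :
    ∀ k ≤ m, ∀ j, HasSum (fun l => (Nat.multichoose k l : ℝ) * d m (j + l)) (d (m - k) j) := by
  have hlim' : ∀ i, Tendsto (d i) atTop (𝓝 0) := by
    intro i
    induction i with
    | zero => exact hlim
    | succ i ih =>
      have := ih.sub ((tendsto_add_atTop_iff_nat 1).2 ih)
      rw [sub_zero] at this
      exact this.congr fun j => (hd i j).symm
  have tele : ∀ i, i + 1 ≤ m → ∀ j, HasSum (fun l => d (i + 1) (j + l)) (d i j) := by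
    intro i hi j
    rw [hasSum_iff_tendsto_nat_of_nonneg fun l => hnn _ hi _]
    simp_rw [sum_diff hd]
    have := ((tendsto_add_atTop_iff_nat j).2 (hlim' i)).const_sub (d i j)
    rw [sub_zero] at this
    exact this.congr fun N => by rw [add_comm]
  intro k
  induction k with
  | zero =>
    intro _ j
    simpa using hasSum_single (f := fun l => (Nat.multichoose 0 l : ℝ) * d m (j + l)) 0
      (fun l hl => by obtain ⟨l, rfl⟩ := Nat.exists_eq_succ_of_ne_zero hl; simp)
  | succ k ih =>
    intro hk j
    have ih := ih (by omega)
    have ht := tele (m - (k + 1)) (by omega) j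
    rw [show m - (k + 1) + 1 = m - k by omega] at ht
    set F : ℕ × ℕ → ℝ := fun p => (Nat.multichoose k p.2 : ℝ) * d m (j + p.1 + p.2) with hF
    have hFs : Summable F := by
      rw [summable_prod_of_nonneg fun p => mul_nonneg (Nat.cast_nonneg _) (hnn m le_rfl _)]
      exact ⟨fun p => (ih (j + p)).summable, ht.summable.congr fun p => ((ih (j + p)).tsum_eq).symm⟩
    have hFv : ∑' p, F p = d (m - (k + 1)) j := by
      rw [hFs.tsum_prod' fun p => (ih (j + p)).summable, ← ht.tsum_eq]
      exact tsum_congr fun p => (ih (j + p)).tsum_eq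
    have h1 : HasSum F (d (m - (k + 1)) j) := hFv ▸ hFs.hasSum
    have h2 : HasSum (fun N => ∑ p ∈ Finset.HasAntidiagonal.antidiagonal N, F p) (d (m - (k + 1)) j) :=
      ((Equiv.hasSum_iff Finset.HasAntidiagonal.sigmaAntidiagonalEquivProd).2 h1).sigma
        fun N => Finset.hasSum (Finset.HasAntidiagonal.antidiagonal N) F
    refine h2.congr_fun fun N => ?_
    rw [Finset.Nat.sum_antidiagonal_eq_sum_range_succ_mk,
      ← Finset.sum_range_reflect, ← sum_multichoose, Nat.cast_sum, Finset.sum_mul]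
    refine Finset.sum_congr rfl fun l hl => ?_
    have hl' := Finset.mem_range.1 hl
    simp only [hF]
    rw [show N - (N + 1 - 1 - l) = l by omega, show j + (N + 1 - 1 - l) + l = j + N by omega]

/-! ### Operator tuples -/

section Tuples

variable {n : ℕ} {H : Type*} [NormedAddCommGroup H] [InnerProductSpace ℂ H] [CompleteSpace H]

/-- The positive square root `A ^ (1/2)` of a positive operator on a Hilbert space. -/
def opSqrt {K : Type*} [NormedAddCommGroup K] [InnerProductSpace ℂ K] [CompleteSpace K]
    (A : K →L[ℂ] K) : K →L[ℂ] K := CFC.sqrt A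

theorem opSqrt_nonneg {K : Type*} [NormedAddCommGroup K] [InnerProductSpace ℂ K] [CompleteSpace K]
    (A : K →L[ℂ] K) : 0 ≤ opSqrt A := CFC.sqrt_nonneg A

theorem opSqrt_mul_self {K : Type*} [NormedAddCommGroup K] [InnerProductSpace ℂ K]
    [CompleteSpace K] {A : K →L[ℂ] K} (hA : 0 ≤ A) : opSqrt A * opSqrt A = A :=
  CFC.sqrt_mul_sqrt_self A hA

/-- The Hilbert space direct sum `Hⁿ`. -/
abbrev PowSpace (n : ℕ) (H : Type*) : Type _ := PiLp 2 (fun _ : Fin n => H)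

/-- The row operator `Hⁿ → H`, `(h_i) ↦ ∑ A_i h_i`. -/
def rowOp (A : Fin n → H →L[ℂ] H) : PowSpace n H →L[ℂ] H :=
  ∑ i, A i ∘L PiLp.proj 2 (fun _ : Fin n => H) i

/-- The map `σ_T(X) = ∑ T_i X T_i^*` on `L(H)`. -/
def sigma (T : Fin n → H →L[ℂ] H) : Module.End ℂ (H →L[ℂ] H) :=
  ∑ i, LinearMap.mulLeftRight ℂ (T i, star (T i))

theorem sigma_apply (T : Fin n → H →L[ℂ] H) (X : H →L[ℂ] H) :
    sigma T X = ∑ i, T i * X * star (T i) := by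
  simp [sigma]

/-- The `k`-th order defect operator `Δ_T^(k) = (1 - σ_T)^k (1_H)`. -/
def defect (T : Fin n → H →L[ℂ] H) (k : ℕ) : H →L[ℂ] H := ((1 - sigma T) ^ k) 1

/-- `T` is an `m`-hypercontraction: a commuting tuple whose defect operators of orders `1` and `m`
are positive. -/
structure IsHypercontraction (m : ℕ) (T : Fin n → H →L[ℂ] H) : Prop where
  comm : ∀ i j, T i * T j = T j * T i
  defect_one_nonneg : 0 ≤ defect T 1
  defect_nonneg : 0 ≤ defect T m

/-- `T` is pure (of class `C_{·0}`): `σ_T^k (1_H) → 0` in the strong operator topology. -/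
def IsPure (T : Fin n → H →L[ℂ] H) : Prop :=
  ∀ x : H, Tendsto (fun k => ((sigma T) ^ k) 1 x) atTop (𝓝 0)

/-- `T ^ α = T_1 ^ α_1 ⋯ T_n ^ α_n`. -/
def tuplePow (T : Fin n → H →L[ℂ] H) (α : Fin n → ℕ) : H →L[ℂ] H :=
  (List.ofFn fun i => T i ^ α i).prod

/-- The defect operator `D_T = (1 - T^* T)^(1/2)` on `Hⁿ` of the row operator `T`. -/
def defectOp (T : Fin n → H →L[ℂ] H) : PowSpace n H →L[ℂ] PowSpace n H :=
  opSqrt (1 - (rowOp T).adjoint ∘L rowOp T)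

/-- The defect space `𝒟_T`, the closure of the range of `D_T`. -/
def defectSpace (T : Fin n → H →L[ℂ] H) : Submodule ℂ (PowSpace n H) :=
  (LinearMap.range (defectOp T).toLinearMap).topologicalClosure

/-- The defect operator `D_{T^*} = (1 - T T^*)^(1/2)` on `H`. -/
def defectOpStar (T : Fin n → H →L[ℂ] H) : H →L[ℂ] H :=
  opSqrt (1 - rowOp T ∘L (rowOp T).adjoint)

/-- The defect space `𝒟_{T^*}`, the closure of the range of `D_{T^*}`. -/
def defectSpaceStar (T : Fin n → H →L[ℂ] H) : Submodule ℂ H :=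
  (LinearMap.range (defectOpStar T).toLinearMap).topologicalClosure

/-- The operator `C = (Δ_T^(m))^(1/2)`. -/
def rootOp (m : ℕ) (T : Fin n → H →L[ℂ] H) : H →L[ℂ] H := opSqrt (defect T m)

/-- The `m`-th order defect space `𝒟`, the closure of the range of `C`. -/
def rootSpace (m : ℕ) (T : Fin n → H →L[ℂ] H) : Submodule ℂ H :=
  (LinearMap.range (rootOp m T).toLinearMap).topologicalClosure

instance (T : Fin n → H →L[ℂ] H) : CompleteSpace (defectSpace T) :=
  (Submodule.isClosed_topologicalClosure _).completeSpace_coe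

instance (T : Fin n → H →L[ℂ] H) : CompleteSpace (defectSpaceStar T) :=
  (Submodule.isClosed_topologicalClosure _).completeSpace_coe

instance (m : ℕ) (T : Fin n → H →L[ℂ] H) : CompleteSpace (rootSpace m T) :=
  (Submodule.isClosed_topologicalClosure _).completeSpace_coe

/-- `D_T` as an operator `𝒟_T → Hⁿ`. -/
def defectOpRestrict (T : Fin n → H →L[ℂ] H) : defectSpace T →L[ℂ] PowSpace n H :=
  defectOp T ∘L (defectSpace T).subtypeL

/-- `D_{T^*}` as an operator `H → 𝒟_{T^*}`. -/
def defectOpStarCod (T : Fin n → H →L[ℂ] H) : H →L[ℂ] defectSpaceStar T :=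
  (defectOpStar T).codRestrict (defectSpaceStar T) fun x =>
    Submodule.le_topologicalClosure _ ⟨x, rfl⟩

/-- `C` as an operator `H → 𝒟`. -/
def rootOpCod (m : ℕ) (T : Fin n → H →L[ℂ] H) : H →L[ℂ] rootSpace m T :=
  (rootOp m T).codRestrict (rootSpace m T) fun x => Submodule.le_topologicalClosure _ ⟨x, rfl⟩

theorem sigma_nonneg (T : Fin n → H →L[ℂ] H) {X : H →L[ℂ] H} (hX : 0 ≤ X) : 0 ≤ sigma T X := by
  rw [sigma_apply]
  exact Finset.sum_nonneg fun i _ => star_right_conjugate_nonneg hX (T i)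

theorem sigma_pow_nonneg (T : Fin n → H →L[ℂ] H) {X : H →L[ℂ] H} (hX : 0 ≤ X) (k : ℕ) :
    0 ≤ (sigma T ^ k) X := by
  induction k with
  | zero => simpa using hX
  | succ k ih => rw [pow_succ']; exact sigma_nonneg T ih

theorem rowOp_apply (A : Fin n → H →L[ℂ] H) (v : PowSpace n H) : rowOp A v = ∑ i, A i (v i) := by
  simp [rowOp]

theorem adjoint_rowOp_apply (A : Fin n → H →L[ℂ] H) (x : H) :
    (rowOp A).adjoint x = WithLp.toLp 2 fun i => star (A i) x := by
  refine ext_inner_right ℂ fun v => ?_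
  rw [ContinuousLinearMap.adjoint_inner_left, rowOp_apply, inner_sum, PiLp.inner_apply]
  refine Finset.sum_congr rfl fun i _ => ?_
  change _ = inner ℂ ((A i).adjoint x) (v i)
  rw [ContinuousLinearMap.adjoint_inner_left]

theorem defect_one (T : Fin n → H →L[ℂ] H) :
    defect T 1 = 1 - rowOp T ∘L (rowOp T).adjoint := by
  have : rowOp T ∘L (rowOp T).adjoint = ∑ i, T i * star (T i) := by
    ext x
    rw [ContinuousLinearMap.comp_apply, adjoint_rowOp_apply, rowOp_apply]
    simp
  rw [this, defect, pow_one, LinearMap.sub_apply, sigma_apply]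
  simp

theorem sigma_pow_apply {T : Fin n → H →L[ℂ] H} (hT : ∀ i j, T i * T j = T j * T i)
    (X : H →L[ℂ] H) (j : ℕ) :
    (sigma T ^ j) X = ∑ α ∈ Finset.piAntidiag Finset.univ j,
      (Nat.multinomial Finset.univ α : ℂ) • (tuplePow T α * X * star (tuplePow T α)) := by
  have hc : ((Finset.univ : Finset (Fin n)) : Set (Fin n)).Pairwise
      (Function.onFun Commute fun i => LinearMap.mulLeftRight ℂ (T i, star (T i))) := by
    intro i _ j _ _
    have h1 := hT i j
    have h2 : star (T i) * star (T j) = star (T j) * star (T i) := by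
      rw [← star_mul, ← star_mul, h1]
    refine LinearMap.ext fun X => ?_
    change T i * (T j * X * star (T j)) * star (T i) = T j * (T i * X * star (T i)) * star (T j)
    calc _ = (T i * T j) * X * (star (T j) * star (T i)) := by simp only [mul_assoc]
      _ = _ := by rw [h1, ← h2]; simp only [mul_assoc]
  have hprod : ∀ (α : Fin n → ℕ) (l : List (Fin n)) (X : H →L[ℂ] H),
      (l.map fun i => LinearMap.mulLeftRight ℂ (T i, star (T i)) ^ α i).prod X
        = (l.map fun i => T i ^ α i).prod * X * star (l.map fun i => T i ^ α i).prod := by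
    intro α l
    induction l with
    | nil => intro X; simp
    | cons i l ih =>
      intro X
      have hp : ∀ (k : ℕ) (Y : H →L[ℂ] H), (LinearMap.mulLeftRight ℂ (T i, star (T i)) ^ k) Y
          = T i ^ k * Y * star (T i ^ k) := by
        intro k
        induction k with
        | zero => intro Y; simp
        | succ k ihk =>
          intro Y
          rw [pow_succ', Module.End.mul_apply, ihk, LinearMap.mulLeftRight_apply, pow_succ',
            star_mul]
          simp only [mul_assoc]
      rw [List.map_cons, List.prod_cons, Module.End.mul_apply, ih, hp, List.map_cons,
        List.prod_cons, star_mul]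
      simp only [mul_assoc]
  rw [sigma, Finset.sum_pow_eq_sum_piAntidiag_of_commute _ _ hc, LinearMap.sum_apply]
  refine Finset.sum_congr rfl fun α _ => ?_
  have h3 := Finset.noncommProd_toFinset (List.finRange n)
    (fun i => LinearMap.mulLeftRight ℂ (T i, star (T i)) ^ α i)
    (fun i _ j _ h => (hc (Finset.mem_coe.2 (Finset.mem_univ i))
      (Finset.mem_coe.2 (Finset.mem_univ j)) h).pow_pow _ _) (List.nodup_finRange n)
  simp only [List.toFinset_finRange] at h3
  rw [h3, Module.End.mul_apply, hprod, tuplePow, List.ofFn_eq_map,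
    Module.End.natCast_apply, Nat.cast_smul_eq_nsmul]

/-- The form `⟨σ_T^j (Δ_T^(i)) x, x⟩`. -/
def defectForm (T : Fin n → H →L[ℂ] H) (x : H) (i j : ℕ) : ℝ :=
  (inner ℂ ((sigma T ^ j) (defect T i) x) x).re

theorem defectForm_succ (T : Fin n → H →L[ℂ] H) (x : H) (i j : ℕ) :
    defectForm T x (i + 1) j = defectForm T x i j - defectForm T x i (j + 1) := by
  have : (sigma T ^ j) (defect T (i + 1))
      = (sigma T ^ j) (defect T i) - (sigma T ^ (j + 1)) (defect T i) := by
    rw [defect, pow_succ', Module.End.mul_apply, ← defect, LinearMap.sub_apply, map_sub,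
      Module.End.one_apply, pow_succ, Module.End.mul_apply]
  rw [defectForm, this]
  simp [defectForm]

theorem re_inner_nonneg_of_nonneg {X : H →L[ℂ] H} (hX : 0 ≤ X) (x : H) :
    0 ≤ (inner ℂ (X x) x).re :=
  ((ContinuousLinearMap.nonneg_iff_isPositive X).1 hX).re_inner_nonneg_left x

section

variable {m : ℕ} {T : Fin n → H →L[ℂ] H}

theorem IsHypercontraction.defectForm_nonneg (hT : IsHypercontraction m T) (x : H) :
    ∀ i ≤ m, ∀ j, 0 ≤ defectForm T x i j := by
  have h0 : ∀ j, 0 ≤ defectForm T x 0 j := fun j => re_inner_nonneg_of_nonneg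
    (sigma_pow_nonneg T (by simp [defect]) j) x
  refine diff_nonneg (defectForm_succ T x) (B := ‖x‖ ^ 2) (fun j => ?_) h0 fun j =>
    re_inner_nonneg_of_nonneg (sigma_pow_nonneg T hT.defect_nonneg j) x
  rw [abs_of_nonneg (h0 j)]
  induction j with
  | zero =>
    have : defectForm T x 0 0 = ‖x‖ ^ 2 := by
      change (inner ℂ x x).re = ‖x‖ ^ 2
      rw [inner_self_eq_norm_sq_to_K]
      norm_cast
    exact this.le
  | succ j ih =>
    have h1 : 0 ≤ defectForm T x 1 j :=
      re_inner_nonneg_of_nonneg (sigma_pow_nonneg T hT.defect_one_nonneg j) x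
    rw [show (1 : ℕ) = 0 + 1 from rfl, defectForm_succ] at h1
    linarith

theorem rootOp_nonneg (m : ℕ) (T : Fin n → H →L[ℂ] H) : 0 ≤ rootOp m T := opSqrt_nonneg _

theorem defectOpStar_nonneg (T : Fin n → H →L[ℂ] H) : 0 ≤ defectOpStar T := opSqrt_nonneg _

theorem defectOpStar_mul_self (hT : IsHypercontraction m T) :
    defectOpStar T * defectOpStar T = 1 - rowOp T ∘L (rowOp T).adjoint :=
  opSqrt_mul_self (defect_one T ▸ hT.defect_one_nonneg)

theorem defectOp_nonneg (T : Fin n → H →L[ℂ] H) : 0 ≤ defectOp T := opSqrt_nonneg _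

theorem norm_adjoint_rowOp_le (hT : IsHypercontraction m T) (x : H) :
    ‖(rowOp T).adjoint x‖ ≤ ‖x‖ := by
  have h := re_inner_nonneg_of_nonneg (defect_one T ▸ hT.defect_one_nonneg) x
  have h2 : inner ℂ ((1 - rowOp T ∘L (rowOp T).adjoint) x) x
      = ((‖x‖ ^ 2 - ‖(rowOp T).adjoint x‖ ^ 2 : ℝ) : ℂ) := by
    change inner ℂ (x - rowOp T ((rowOp T).adjoint x)) x = _
    rw [inner_sub_left, ← ContinuousLinearMap.adjoint_inner_right, inner_self_eq_norm_sq_to_K,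
      inner_self_eq_norm_sq_to_K]
    push_cast
    rfl
  rw [h2, Complex.ofReal_re] at h
  exact (sq_le_sq₀ (norm_nonneg _) (norm_nonneg _)).1 (by linarith)

theorem norm_rowOp_le (hT : IsHypercontraction m T) : ‖rowOp T‖ ≤ 1 := by
  rw [← LinearIsometryEquiv.norm_map ContinuousLinearMap.adjoint (rowOp T)]
  exact ContinuousLinearMap.opNorm_le_bound _ zero_le_one fun x => by
    simpa using norm_adjoint_rowOp_le hT x

theorem defectOp_mul_self (hT : IsHypercontraction m T) :
    defectOp T * defectOp T = 1 - (rowOp T).adjoint ∘L rowOp T := by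
  refine opSqrt_mul_self ?_
  rw [ContinuousLinearMap.nonneg_iff_isPositive, ContinuousLinearMap.isPositive_def']
  refine ⟨?_, fun v => ?_⟩
  · rw [IsSelfAdjoint, star_sub, star_one, ContinuousLinearMap.star_eq_adjoint,
      ContinuousLinearMap.adjoint_comp, ContinuousLinearMap.adjoint_adjoint]
  · rw [ContinuousLinearMap.reApplyInnerSelf_apply]
    change 0 ≤ RCLike.re (inner ℂ (v - (rowOp T).adjoint (rowOp T v)) v)
    rw [inner_sub_left, ContinuousLinearMap.adjoint_inner_left, map_sub,
      inner_self_eq_norm_sq, inner_self_eq_norm_sq, sub_nonneg]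
    have h := (rowOp T).le_of_opNorm_le (norm_rowOp_le hT) v
    rw [one_mul] at h
    gcongr

theorem rootOp_mul_self (hT : IsHypercontraction m T) : rootOp m T * rootOp m T = defect T m :=
  opSqrt_mul_self hT.defect_nonneg

theorem inner_conj_sqrt {K : Type*} [NormedAddCommGroup K] [InnerProductSpace ℂ K]
    [CompleteSpace K] {A X : K →L[ℂ] K} (hA : 0 ≤ A) (h : A * A = X) (x : K) :
    (inner ℂ (X x) x).re = ‖A x‖ ^ 2 := by
  have hs : IsSelfAdjoint A := IsSelfAdjoint.of_nonneg hA
  rw [← h, FunLike.coe_mul_eq_comp, Function.comp_apply, ← ContinuousLinearMap.adjoint_inner_right,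
    ← ContinuousLinearMap.star_eq_adjoint, hs.star_eq, inner_self_eq_norm_sq_to_K]
  norm_cast

theorem defectForm_eq_sum (hT : IsHypercontraction m T) (x : H) (j : ℕ) :
    defectForm T x m j = ∑ α ∈ Finset.piAntidiag Finset.univ j,
      (Nat.multinomial Finset.univ α : ℝ) * ‖rootOp m T (star (tuplePow T α) x)‖ ^ 2 := by
  rw [defectForm, sigma_pow_apply hT.comm, sum_apply, sum_inner, Complex.re_sum]
  refine Finset.sum_congr rfl fun α _ => ?_
  have h3 : inner ℂ (((Nat.multinomial Finset.univ α : ℂ) •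
      (tuplePow T α * defect T m * star (tuplePow T α))) x) x
      = (Nat.multinomial Finset.univ α : ℂ) *
        inner ℂ (defect T m (star (tuplePow T α) x)) (star (tuplePow T α) x) := by
    change inner ℂ ((Nat.multinomial Finset.univ α : ℂ) •
      tuplePow T α (defect T m (star (tuplePow T α) x))) x = _
    rw [inner_smul_left, Complex.conj_natCast, ContinuousLinearMap.star_eq_adjoint,
      ContinuousLinearMap.adjoint_inner_right]
  rw [h3, ← Complex.ofReal_natCast, Complex.re_ofReal_mul,
    inner_conj_sqrt (rootOp_nonneg m T) (rootOp_mul_self hT)]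

theorem tendsto_defectForm_zero (hP : IsPure T) (x : H) :
    Tendsto (defectForm T x 0) atTop (𝓝 0) := by
  have h1 : Tendsto (fun k => inner ℂ (((sigma T) ^ k) 1 x) x) atTop (𝓝 (inner ℂ (0 : H) x)) :=
    (hP x).inner tendsto_const_nhds
  rw [inner_zero_left] at h1
  exact (Complex.continuous_re.tendsto _).comp h1

theorem IsHypercontraction.hasSum_norm_sq (hT : IsHypercontraction m T) (hP : IsPure T) {k : ℕ}
    (hk : k ≤ m) (x : H) :
    HasSum (fun α : Fin n → ℕ => (rho k α : ℝ) * ‖rootOp m T (star (tuplePow T α) x)‖ ^ 2)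
      (inner ℂ (defect T (m - k) x) x).re := by
  have h : HasSum (fun l => (Nat.multichoose k l : ℝ) * defectForm T x m (0 + l))
      (inner ℂ (defect T (m - k) x) x).re :=
    hasSum_diff (defectForm_succ T x) (hT.defectForm_nonneg x) (tendsto_defectForm_zero hP x) k hk 0
  refine hasSum_of_degree (fun α => by positivity) (h.congr_fun fun j => ?_)
  rw [zero_add, defectForm_eq_sum hT, Finset.mul_sum]
  refine Finset.sum_congr rfl fun α hα => ?_
  rw [Finset.mem_piAntidiag] at hα
  rw [rho, hα.1]
  push_cast
  ring

/-- The operator `j_k : H → H_k(𝔹, 𝒟)`, `j_k(x) = ∑ ρ_k(α) (C T^{*α} x) z ^ α`, for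
`0 ≤ k ≤ m`; its normalized coefficients are `ρ_k(α) ^ (1/2) C T^{*α} x`. -/
def jMap (hT : IsHypercontraction m T) (hP : IsPure T) (k : ℕ) (hk : k ≤ m) :
    H →ₗ[ℂ] HSpace n k (rootSpace m T) where
  toFun x := HSpace.mk
    (fun α => (√(rho k α.1 : ℝ) : ℂ) • rootOpCod m T (star (tuplePow T α.1) x)) (by
      refine ((hT.hasSum_norm_sq hP hk x).summable.subtype {α | rho k α ≠ 0}).congr fun α => ?_
      rw [norm_smul, mul_pow, Complex.norm_real, Real.norm_eq_abs, sq_abs,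
        Real.sq_sqrt (by positivity)]
      rfl)
  map_add' x y := by ext α; simp
  map_smul' c x := by
    refine HSpace.ext_ncoeff fun α => ?_
    simp [smul_comm c]

theorem norm_jMap_sq (hT : IsHypercontraction m T) (hP : IsPure T) (k : ℕ) (hk : k ≤ m) (x : H) :
    ‖jMap hT hP k hk x‖ ^ 2 = (inner ℂ (defect T (m - k) x) x).re := by
  refine (jMap hT hP k hk x).hasSum_norm_sq.unique ?_
  have h := (hasSum_idx_iff (l := k) _ fun α h => by rw [h, Nat.cast_zero, zero_mul]).2
    (hT.hasSum_norm_sq hP hk x)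
  refine h.congr_fun fun α => ?_
  change ‖(√(rho k α.1 : ℝ) : ℂ) • rootOpCod m T (star (tuplePow T α.1) x)‖ ^ 2 = _
  rw [norm_smul, mul_pow, Complex.norm_real, Real.norm_eq_abs, sq_abs,
        Real.sq_sqrt (by positivity)]
  rfl

/-- The operator `π = j_{m-1} : H → H_{m-1}(𝔹, 𝒟)`. -/
def piMap (hT : IsHypercontraction m T) (hP : IsPure T) :
    H →ₗ[ℂ] HSpace n (m - 1) (rootSpace m T) :=
  jMap hT hP (m - 1) (Nat.sub_le m 1)

theorem norm_piMap (hm : 1 ≤ m) (hT : IsHypercontraction m T) (hP : IsPure T) (x : H) :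
    ‖piMap hT hP x‖ = ‖defectOpStarCod T x‖ := by
  have h1 := norm_jMap_sq hT hP (m - 1) (Nat.sub_le m 1) x
  rw [show m - (m - 1) = 1 by omega, defect_one,
    inner_conj_sqrt (defectOpStar_nonneg T) (defectOpStar_mul_self hT)] at h1
  exact (sq_eq_sq₀ (norm_nonneg _) (norm_nonneg _)).1 h1

/-- The space `M = H_{m-1}(𝔹, 𝒟) ⊖ Im π`. -/
def complSpace (hT : IsHypercontraction m T) (hP : IsPure T) :
    Submodule ℂ (HSpace n (m - 1) (rootSpace m T)) :=
  (LinearMap.range (piMap hT hP))ᗮ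

/-- The isometry `U : 𝒟_{T^*} → H_{m-1}(𝔹, 𝒟)` (for `m ≥ 1`), which is the continuous extension
of `D_{T^*} x ↦ π x` and maps onto the closure of `Im π`; see `unitaryU_apply` and
`norm_unitaryU`. -/
def unitaryU (hT : IsHypercontraction m T) (hP : IsPure T) :
    defectSpaceStar T →L[ℂ] HSpace n (m - 1) (rootSpace m T) :=
  (piMap hT hP).extendOfNorm (defectOpStarCod T).toLinearMap

theorem denseRange_defectOpStarCod (T : Fin n → H →L[ℂ] H) :
    DenseRange (defectOpStarCod T) := by
  intro y
  have h : (y : H) ∈ closure (Set.range (defectOpStar T)) := y.2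
  rw [Topology.IsInducing.subtypeVal.closure_eq_preimage_closure_image, ← Set.range_comp]
  exact h

theorem unitaryU_apply (hm : 1 ≤ m) (hT : IsHypercontraction m T) (hP : IsPure T) (x : H) :
    unitaryU hT hP (defectOpStarCod T x) = piMap hT hP x :=
  LinearMap.extendOfNorm_eq (denseRange_defectOpStarCod T)
    ⟨1, fun x => by rw [one_mul]; exact (norm_piMap hm hT hP x).le⟩ x

theorem norm_unitaryU (hm : 1 ≤ m) (hT : IsHypercontraction m T) (hP : IsPure T)
    (y : defectSpaceStar T) : ‖unitaryU hT hP y‖ = ‖y‖ := by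
  refine (denseRange_defectOpStarCod T).induction_on y
    (isClosed_eq (unitaryU hT hP).continuous.norm continuous_norm) fun x => ?_
  rw [unitaryU_apply hm, norm_piMap hm]

/-- The domain `𝒟_T ⊕ M` of the characteristic function, with the Hilbert space norm. -/
abbrev CharDomain (hT : IsHypercontraction m T) (hP : IsPure T) : Type _ :=
  WithLp 2 (defectSpace T × complSpace hT hP)

/-- `V = (U, i_M) : 𝒟_{T^*} ⊕ M → H_{m-1}(𝔹, 𝒟)`. -/
def unitaryV (hT : IsHypercontraction m T) (hP : IsPure T) :
    WithLp 2 (defectSpaceStar T × complSpace hT hP) →L[ℂ] HSpace n (m - 1) (rootSpace m T) :=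
  unitaryU hT hP ∘L WithLp.fstL 2 ℂ _ _ + (complSpace hT hP).subtypeL ∘L WithLp.sndL 2 ℂ _ _

/-- The point evaluation `ε_z : H_ℓ(𝔹, E) → E`, `f ↦ f(z)`. -/
def pointEval (l : ℕ) (E : Type*) [NormedAddCommGroup E] [InnerProductSpace ℂ E] [CompleteSpace E]
    (z : Ball n) : HSpace n l E →L[ℂ] E :=
  ContinuousLinearMap.proj z ∘L RKHS.coeCLM ℂ

/-- The row operator `T` maps `𝒟_T` into `𝒟_{T^*}`. -/
theorem rowOp_mem (hT : IsHypercontraction m T) (x : defectSpace T) :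
    rowOp T (x : PowSpace n H) ∈ defectSpaceStar T := by
  have hA : IsSelfAdjoint (defectOp T) := IsSelfAdjoint.of_nonneg (defectOp_nonneg T)
  have hB : IsSelfAdjoint (defectOpStar T) := IsSelfAdjoint.of_nonneg (defectOpStar_nonneg T)
  rw [defectSpaceStar, ← Submodule.orthogonal_orthogonal_eq_closure, Submodule.mem_orthogonal]
  intro y hy
  have hy0 : defectOpStar T y = 0 := by
    refine ext_inner_right ℂ fun v => ?_
    rw [inner_zero_left, ← ContinuousLinearMap.adjoint_inner_right,
      ← ContinuousLinearMap.star_eq_adjoint, hB.star_eq, ← inner_conj_symm]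
    have h : inner ℂ (defectOpStar T v) y = 0 := (Submodule.mem_orthogonal _ y).1 hy _ ⟨v, rfl⟩
    rw [h, map_zero]
  have hTy : rowOp T ((rowOp T).adjoint y) = y := by
    have h := congrArg (fun A : H →L[ℂ] H => A y) (defectOpStar_mul_self hT)
    change defectOpStar T (defectOpStar T y) = y - rowOp T ((rowOp T).adjoint y) at h
    rw [hy0, map_zero] at h
    exact (sub_eq_zero.1 h.symm).symm
  have hD : defectOp T ((rowOp T).adjoint y) = 0 := by
    have h := inner_conj_sqrt (defectOp_nonneg T) (defectOp_mul_self hT) ((rowOp T).adjoint y)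
    change (inner ℂ ((rowOp T).adjoint y - (rowOp T).adjoint (rowOp T ((rowOp T).adjoint y)))
      ((rowOp T).adjoint y)).re = _ at h
    rw [hTy, sub_self, inner_zero_left, Complex.zero_re] at h
    exact norm_eq_zero.1 (pow_eq_zero_iff two_ne_zero |>.1 h.symm)
  rw [← ContinuousLinearMap.adjoint_inner_left]
  have hx : (x : PowSpace n H) ∈ (LinearMap.range (defectOp T).toLinearMap)ᗮᗮ := by
    rw [Submodule.orthogonal_orthogonal_eq_closure]; exact x.2
  refine (Submodule.mem_orthogonal _ _).1 hx _ ((Submodule.mem_orthogonal _ _).2 ?_)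
  rintro _ ⟨v, rfl⟩
  change inner ℂ (defectOp T v) _ = 0
  rw [← ContinuousLinearMap.adjoint_inner_right, ← ContinuousLinearMap.star_eq_adjoint, hA.star_eq,
    hD, inner_zero_right]

/-- The row operator `T` as an operator `𝒟_T → 𝒟_{T^*}`. -/
def rowOpRestrict (hT : IsHypercontraction m T) : defectSpace T →L[ℂ] defectSpaceStar T :=
  (rowOp T ∘L (defectSpace T).subtypeL).codRestrict (defectSpaceStar T) (rowOp_mem hT)

/-- `T ⊕ 1_M : 𝒟_T ⊕ M → 𝒟_{T^*} ⊕ M`. -/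
def rowOpSum (hT : IsHypercontraction m T) (hP : IsPure T) :
    CharDomain hT hP →L[ℂ] WithLp 2 (defectSpaceStar T × complSpace hT hP) :=
  (WithLp.prodContinuousLinearEquiv 2 ℂ _ _).symm.toContinuousLinearMap ∘L
    (rowOpRestrict hT).prodMap (.id ℂ _) ∘L
      (WithLp.prodContinuousLinearEquiv 2 ℂ _ _).toContinuousLinearMap

/-- `Δ_1(z) = ε_z ∘ V : 𝒟_{T^*} ⊕ M → 𝒟`. -/
def deltaOne (hT : IsHypercontraction m T) (hP : IsPure T) (z : Ball n) :
    WithLp 2 (defectSpaceStar T × complSpace hT hP) →L[ℂ] rootSpace m T :=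
  pointEval (m - 1) (rootSpace m T) z ∘L unitaryV hT hP

/-- `Δ_0 = ε_0 ∘ U : 𝒟_{T^*} → 𝒟`. -/
def deltaZero (hT : IsHypercontraction m T) (hP : IsPure T) :
    defectSpaceStar T →L[ℂ] rootSpace m T :=
  pointEval (m - 1) (rootSpace m T) (Ball.origin n) ∘L unitaryU hT hP

/-- The row operator `Z = (z_1 1_H, …, z_n 1_H) : Hⁿ → H`. -/
def rowZ (z : Ball n) : PowSpace n H →L[ℂ] H := rowOp fun i => z.1 i • (1 : H →L[ℂ] H)

/-- The operator `1_H - Z T^*` is invertible for every point of the ball. -/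
theorem isUnit_one_sub (hT : IsHypercontraction m T) (z : Ball n) :
    IsUnit (1 - rowZ z ∘L (rowOp T).adjoint : H →L[ℂ] H) := by
  have hz : ‖z.1‖ < 1 := mem_ball_zero_iff.1 z.2
  refine isUnit_one_sub_of_norm_lt_one (lt_of_le_of_lt ?_ hz)
  have hZ : ∀ x : H, ‖(rowZ (H := H) z).adjoint x‖ = ‖z.1‖ * ‖x‖ := fun x => by
    have : (rowZ (H := H) z).adjoint x = WithLp.toLp 2 fun i => starRingEnd ℂ (z.1 i) • x := by
      rw [rowZ, adjoint_rowOp_apply]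
      congr 1
      funext i
      rw [star_smul, star_one]
      rfl
    rw [← sq_eq_sq₀ (by positivity) (by positivity), this, PiLp.norm_sq_eq_of_L2, mul_pow,
      EuclideanSpace.norm_sq_eq, Finset.sum_mul]
    refine Finset.sum_congr rfl fun i _ => ?_
    change ‖starRingEnd ℂ (z.1 i) • x‖ ^ 2 = _
    rw [norm_smul, RCLike.norm_conj, mul_pow]
  have h1 : ‖rowZ (H := H) z‖ ≤ ‖z.1‖ := by
    rw [← LinearIsometryEquiv.norm_map ContinuousLinearMap.adjoint (rowZ (H := H) z)]
    exact ContinuousLinearMap.opNorm_le_bound _ (norm_nonneg _) fun x => (hZ x).le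
  have h2 : ‖(rowOp T).adjoint‖ ≤ 1 := by
    rw [LinearIsometryEquiv.norm_map]; exact norm_rowOp_le hT
  calc ‖rowZ z ∘L (rowOp T).adjoint‖ ≤ ‖rowZ (H := H) z‖ * ‖(rowOp T).adjoint‖ :=
        ContinuousLinearMap.opNorm_comp_le _ _
    _ ≤ ‖z.1‖ * 1 := mul_le_mul h1 h2 (norm_nonneg _) (norm_nonneg _)
    _ = ‖z.1‖ := mul_one _

/-- The characteristic function
`θ_T(z) = -Δ_1(z) (T ⊕ 1_M) + Δ_0 D_{T^*} (1_H - Z T^*)^(-m) Z (D_T, 0)`, an operator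
`𝒟_T ⊕ M → 𝒟` for every `z` in the ball. -/
def charFun (hT : IsHypercontraction m T) (hP : IsPure T) (z : Ball n) :
    CharDomain hT hP →L[ℂ] rootSpace m T :=
  -(deltaOne hT hP z ∘L rowOpSum hT hP) +
    deltaZero hT hP ∘L defectOpStarCod T ∘L
      ((Ring.inverse (1 - rowZ z ∘L (rowOp T).adjoint)) ^ m : H →L[ℂ] H) ∘L
        rowZ z ∘L defectOpRestrict T ∘L WithLp.fstL 2 ℂ _ _

end

end Tuples

end Hypercontraction

end

/-! At the origin the row operator `Z` vanishes, so the second summand of the characteristic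
function disappears and `θ_T(0) = -ε_0 V (T ⊕ 1_M)`. Each of the three factors is a contraction: `T
⊕ 1_M` because `‖T‖ ≤ 1`, `V` because it is an isometry, and `ε_0` because it reads off the constant
coefficient, which has weight `ρ(0) = 1` in the norm. Hence only equality has to be excluded.

Suppose that `‖θ_T(0)x‖ ≥ ‖x‖` for `x = (v, f)`. Then nothing is lost at any stage of the chain. At
the first factor this gives `‖Tv‖ = ‖v‖`, that is, `D_T v = 0`; since `v` lies in the closure of the
range of the self-adjoint operator `D_T`, it is orthogonal to its own space and `v = 0`
(`eq_zero_of_norm_le_norm_rowOpRestrict`). What remains is `f ∈ M` whose norm is attained by its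
constant coefficient, so `f` is a constant function `f_0 ∈ 𝒟`. Orthogonality to `Im π` now reads
`⟨Cx, f_0⟩ = 0` for all `x ∈ H`, because `Cx` is the constant coefficient of `πx`. As `𝒟` is the
closure of the range of `C`, this forces `f_0 = 0` (`eq_zero_of_mem_complSpace`). Thus `x = 0`. -/

namespace Hypercontraction

/-! ### Evaluation at the origin and the constant coefficient. -/

section HSpace

variable {n l : ℕ} {E : Type*} [NormedAddCommGroup E]

/-- The case `l = 0` is included, so the index `0` is available in every `Idx n l`, in particular
for `m = 1`, where `m - 1 = 0`. -/
theorem rho_zero (n l : ℕ) : rho l (0 : Fin n → ℕ) = 1 := by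
  simp [rho, Nat.multinomial]

/-- The multiindex `0`. -/
def Idx.zero (n l : ℕ) : Idx n l := ⟨0, by rw [rho_zero]; exact one_ne_zero⟩

theorem monomial_zero_zero : monomial (0 : EuclideanSpace ℂ (Fin n)) 0 = 1 := by
  simp [monomial]

theorem monomial_zero_of_ne_zero {α : Fin n → ℕ} (hα : α ≠ 0) :
    monomial (0 : EuclideanSpace ℂ (Fin n)) α = 0 := by
  obtain ⟨i, hi⟩ := Function.ne_iff.1 hα
  exact Finset.prod_eq_zero (Finset.mem_univ i) (by simpa using hi)

/-- Two terms of the Parseval sum. With `β` the zero index, it shows that a constant coefficient of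
full norm leaves no room for any other coefficient. -/
theorem HSpace.norm_sq_add_norm_sq_le (f : HSpace n l E) {α β : Idx n l} (h : α ≠ β) :
    ‖f.ncoeff α‖ ^ 2 + ‖f.ncoeff β‖ ^ 2 ≤ ‖f‖ ^ 2 := by
  classical
  rw [← Finset.sum_pair (f := fun γ => ‖f.ncoeff γ‖ ^ 2) h]
  exact sum_le_hasSum _ (fun _ _ => by positivity) f.hasSum_norm_sq

/-- At the zero index this is the contractivity of `ε_0`. -/
theorem HSpace.norm_ncoeff_le (f : HSpace n l E) (α : Idx n l) : ‖f.ncoeff α‖ ≤ ‖f‖ :=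
  (sq_le_sq₀ (norm_nonneg _) (norm_nonneg _)).1
    (le_hasSum f.hasSum_norm_sq α fun _ _ => by positivity)

/-- A function whose constant coefficient exhausts the norm is constant. -/
theorem HSpace.ncoeff_eq_zero_of_norm_le {f : HSpace n l E}
    (h : ‖f‖ ≤ ‖f.ncoeff (Idx.zero n l)‖) {α : Idx n l} (hα : α ≠ Idx.zero n l) :
    f.ncoeff α = 0 := by
  have h1 := f.norm_sq_add_norm_sq_le hα
  have h2 : ‖f‖ ^ 2 ≤ ‖f.ncoeff (Idx.zero n l)‖ ^ 2 := by gcongr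
  exact norm_eq_zero.1 (pow_eq_zero_iff two_ne_zero |>.1
    (le_antisymm (by linarith) (sq_nonneg _)))

variable [InnerProductSpace ℂ E]

/-- All monomials except the constant one vanish at the origin, and the normalizing factor `ρ(0) ^
(1/2)` equals `1`, so normalized and ordinary constant coefficients agree. -/
theorem HSpace.eval_origin (f : HSpace n l E) :
    f.eval (Ball.origin n) = f.ncoeff (Idx.zero n l) := by
  rw [HSpace.eval, tsum_eq_single (Idx.zero n l)]
  · simp [Idx.zero, Ball.origin, rho_zero, monomial_zero_zero]
  · intro α hα
    have h : α.1 ≠ 0 := fun h => hα (Subtype.ext h)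
    simp [Ball.origin, monomial_zero_of_ne_zero h]

theorem pointEval_origin [CompleteSpace E] (f : HSpace n l E) :
    pointEval l E (Ball.origin n) f = f.ncoeff (Idx.zero n l) :=
  f.eval_origin

end HSpace

/-- The closure of the range is the double orthogonal complement of the range, so `y` is orthogonal
to itself. This settles both equality cases: it is applied to `D_T` and to `C`. -/
theorem eq_zero_of_mem_closure_range {K : Type*} [NormedAddCommGroup K] [InnerProductSpace ℂ K]
    [CompleteSpace K] {A : K →L[ℂ] K} {y : K}
    (hy : y ∈ (LinearMap.range A.toLinearMap).topologicalClosure) (h : ∀ x, inner ℂ (A x) y = 0) :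
    y = 0 := by
  rw [← Submodule.orthogonal_orthogonal_eq_closure] at hy
  refine inner_self_eq_zero.1 ((Submodule.mem_orthogonal _ y).1 hy y ?_)
  rw [Submodule.mem_orthogonal]
  rintro _ ⟨x, rfl⟩
  exact h x

/-! ### The equality cases on `𝒟_T` and on `M`, and the isometry `V`. -/

section Tuples

variable {n m : ℕ} {H : Type*} [NormedAddCommGroup H] [InnerProductSpace ℂ H] [CompleteSpace H]
  {T : Fin n → H →L[ℂ] H}

/-- The quadratic form of `D_T² = 1 - T^*T`: the defect operator measures exactly the norm lost
under `T`. -/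
theorem norm_sq_defectOp (hT : IsHypercontraction m T) (v : PowSpace n H) :
    ‖defectOp T v‖ ^ 2 = ‖v‖ ^ 2 - ‖rowOp T v‖ ^ 2 := by
  rw [← inner_conj_sqrt (defectOp_nonneg T) (defectOp_mul_self hT)]
  change RCLike.re (inner ℂ (v - (rowOp T).adjoint (rowOp T v)) v) = _
  rw [inner_sub_left, ContinuousLinearMap.adjoint_inner_left, map_sub,
    inner_self_eq_norm_sq, inner_self_eq_norm_sq]

theorem norm_rowOpRestrict_le (hT : IsHypercontraction m T) (v : defectSpace T) :
    ‖rowOpRestrict hT v‖ ≤ ‖v‖ := by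
  have h := (rowOp T).le_of_opNorm_le (norm_rowOp_le hT) (v : PowSpace n H)
  rwa [one_mul] at h

/-- The row operator is strictly contractive on non-zero vectors of `𝒟_T`. -/
theorem eq_zero_of_norm_le_norm_rowOpRestrict (hT : IsHypercontraction m T) {v : defectSpace T}
    (h : ‖v‖ ≤ ‖rowOpRestrict hT v‖) : v = 0 := by
  have h1 : ‖(v : PowSpace n H)‖ ≤ ‖rowOp T v‖ := h
  have h2 : ‖(v : PowSpace n H)‖ ^ 2 ≤ ‖rowOp T v‖ ^ 2 := by gcongr
  have h3 := norm_sq_defectOp hT (v : PowSpace n H)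
  have h4 : defectOp T v = 0 := norm_eq_zero.1 (pow_eq_zero_iff two_ne_zero |>.1
    (le_antisymm (by linarith) (sq_nonneg _)))
  have hA : IsSelfAdjoint (defectOp T) := IsSelfAdjoint.of_nonneg (defectOp_nonneg T)
  refine Subtype.ext (eq_zero_of_mem_closure_range v.2 fun x => ?_)
  -- Self-adjointness moves `D_T` to the other side: `⟨D_T x, v⟩ = ⟨x, D_T v⟩ = 0`.
  rw [← ContinuousLinearMap.adjoint_inner_right, ← ContinuousLinearMap.star_eq_adjoint,
    hA.star_eq, h4, inner_zero_right]

/-- Both `ρ(0)` and `T^{*0}` are trivial. This is how the range of `C`, which is dense in `𝒟`,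
enters the argument. -/
theorem ncoeff_piMap_zero (hT : IsHypercontraction m T) (hP : IsPure T) (x : H) :
    (piMap hT hP x).ncoeff (Idx.zero n (m - 1)) = rootOpCod m T x := by
  change (√(rho (m - 1) (0 : Fin n → ℕ) : ℝ) : ℂ) • rootOpCod m T (star (tuplePow T 0) x) = _
  simp [rho_zero, tuplePow]

/-- `M` contains no non-zero constant function. -/
theorem eq_zero_of_mem_complSpace (hT : IsHypercontraction m T) (hP : IsPure T)
    {f : HSpace n (m - 1) (rootSpace m T)} (hf : f ∈ complSpace hT hP)
    (h : ‖f‖ ≤ ‖f.ncoeff (Idx.zero n (m - 1))‖) : f = 0 := by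
  -- By `h` it is enough to kill the constant coefficient.
  have h0 : f.ncoeff (Idx.zero n (m - 1)) = 0 := by
    refine Subtype.ext (eq_zero_of_mem_closure_range (f.ncoeff (Idx.zero n (m - 1))).2 fun x => ?_)
    have h1 : inner ℂ (piMap hT hP x) f = 0 := (Submodule.mem_orthogonal _ f).1 hf _ ⟨x, rfl⟩
    -- Since `f` is constant, the series for `⟨πx, f⟩` collapses to its term at `0`, which is `⟨Cx,
    -- f_0⟩`.
    rw [HSpace.inner_eq_tsum, tsum_eq_single (Idx.zero n (m - 1)) fun α hα => by
      rw [HSpace.ncoeff_eq_zero_of_norm_le h hα, inner_zero_right], ncoeff_piMap_zero] at h1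
    exact h1
  rw [h0, norm_zero] at h
  exact norm_le_zero_iff.1 h

/-- On the dense set of vectors `D_{T^*} x` the value of `U` is `πx`, which is orthogonal to `M` by
definition; the general case follows by continuity. -/
theorem inner_unitaryU_of_mem_complSpace (hm : 1 ≤ m) (hT : IsHypercontraction m T)
    (hP : IsPure T) (y : defectSpaceStar T) {f : HSpace n (m - 1) (rootSpace m T)}
    (hf : f ∈ complSpace hT hP) : inner ℂ (unitaryU hT hP y) f = 0 := by
  refine (denseRange_defectOpStarCod T).induction_on y
    (isClosed_eq ((unitaryU hT hP).continuous.inner continuous_const) continuous_const) fun x => ?_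
  rw [unitaryU_apply hm]
  exact (Submodule.mem_orthogonal _ f).1 hf _ ⟨x, rfl⟩

/-- Pythagoras: `U` is isometric and its range is orthogonal to `M`. -/
theorem norm_sq_unitaryV (hm : 1 ≤ m) (hT : IsHypercontraction m T) (hP : IsPure T)
    (y : WithLp 2 (defectSpaceStar T × complSpace hT hP)) :
    ‖unitaryV hT hP y‖ ^ 2 = ‖y.fst‖ ^ 2 + ‖y.snd‖ ^ 2 := by
  change ‖unitaryU hT hP y.fst + (y.snd : HSpace n (m - 1) (rootSpace m T))‖ ^ 2 = _
  have h := norm_add_sq_eq_norm_sq_add_norm_sq_of_inner_eq_zero _ _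
    (inner_unitaryU_of_mem_complSpace hm hT hP y.fst y.snd.2)
  rw [sq, h, norm_unitaryU hm, ← sq, ← sq]
  rfl

/-- The summand containing the `m`-th power of the inverse has the factor `Z`, which is `0` at the
origin; only `-ε_0 V (T ⊕ 1_M)` survives. -/
theorem charFun_origin (hT : IsHypercontraction m T) (hP : IsPure T) (x : CharDomain hT hP) :
    charFun hT hP (Ball.origin n) x
      = -(unitaryV hT hP (rowOpSum hT hP x)).ncoeff (Idx.zero n (m - 1)) := by
  have h0 : rowZ (H := H) (Ball.origin n) = 0 := by
    ext v
    simp [rowZ, rowOp_apply, Ball.origin]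
  simp only [charFun, h0, ContinuousLinearMap.zero_comp, ContinuousLinearMap.comp_zero, add_zero]
  rw [← pointEval_origin]
  rfl

end Tuples

end Hypercontraction

/-! ### Strict contractivity at the origin. -/

open Hypercontraction in
theorem mainTheorem8 {n m : ℕ} (hm : 1 ≤ m)
    {H : Type*} [NormedAddCommGroup H] [InnerProductSpace ℂ H] [CompleteSpace H]
    (T : Fin n → H →L[ℂ] H) (hT : Hypercontraction.IsHypercontraction m T)
    (hP : Hypercontraction.IsPure T)
    (x : Hypercontraction.CharDomain hT hP) (hx : x ≠ 0) :
    ‖Hypercontraction.charFun hT hP (Hypercontraction.Ball.origin n) x‖ < ‖x‖ := by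
  rw [charFun_origin, norm_neg]
  by_contra! h
  have h1 := HSpace.norm_ncoeff_le (unitaryV hT hP (rowOpSum hT hP x)) (Idx.zero n (m - 1))
  -- Dropping `ε_0` from the chain isolates the loss at `T ⊕ 1_M`, because `V` is isometric.
  have h2 : ‖x‖ ^ 2 ≤ ‖unitaryV hT hP (rowOpSum hT hP x)‖ ^ 2 := by gcongr; exact h.trans h1
  rw [norm_sq_unitaryV hm, WithLp.prod_norm_sq_eq_of_L2] at h2
  change _ ≤ ‖rowOpRestrict hT x.fst‖ ^ 2 + ‖x.snd‖ ^ 2 at h2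
  -- The component in `M` contributes `‖x.snd‖ ^ 2` to both sides of `h2` and cancels.
  have hfst : x.fst = 0 := eq_zero_of_norm_le_norm_rowOpRestrict hT
    ((sq_le_sq₀ (norm_nonneg _) (norm_nonneg _)).1 (by linarith))
  have hV : unitaryV hT hP (rowOpSum hT hP x) = x.snd := by
    change unitaryU hT hP (rowOpRestrict hT x.fst) + _ = _
    rw [hfst, map_zero, map_zero, zero_add]
    rfl
  have hn : ‖x‖ ^ 2 = ‖x.snd‖ ^ 2 := by
    rw [WithLp.prod_norm_sq_eq_of_L2, hfst, norm_zero]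
    ring
  -- With the first component gone, `h` says that the constant coefficient of `x.snd ∈ M` exhausts
  -- its norm.
  rw [hV, (sq_eq_sq₀ (norm_nonneg _) (norm_nonneg _)).1 hn] at h
  have hsnd : x.snd = 0 := Subtype.ext (eq_zero_of_mem_complSpace hT hP x.snd.2 h)
  exact hx (WithLp.ofLp_injective 2 (Prod.ext hfst hsnd))
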